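/- Let $d\ge 1$ and let $\boldsymbol\alpha=(\alpha_1,\dots,\alpha_d)\in\mathbb R^d$ be such that $1,\alpha_1,\dots,\alpha_d$ are linearly independent over $\mathbb Q$ and all lie in a field $K\subset\mathbb R$ with $[K:\mathbb Q]=d+1$ (so they form a $\mathbb Q$-basis of $K$). For $\boldsymbol x\in\mathbb R^d$ put $\langle\boldsymbol x\rangle=\max_{1\le j\le d}\min_{k\in\mathbb Z}|x_j-k|$. Define $N_1=1$ and, for $i\ge 2$, let $N_i$ be the smallest integer $N>N_{i-1}$ with $\langle N\boldsymbol\alpha\rangle<\langle N_{i-1}\boldsymbol\alpha\rangle$; let $\boldsymbol z^{(i)}\in\mathbb Z^d$ be the vector whose $j$-th entry is the nearest integer to $N_i\alpha_j$. For $N\ge1$ and $\boldsymbol z\in\mathbb Z^d$ let \[ P_{N,\boldsymbol z}=\left\{\left(\left\{\tfrac{nz_1}{N}\right\},\dots,\left\{\tfrac{nz_d}{N}\right\}\right) : n=0,1,\dots,N-1\right\}\subset[0,1]^d, \] where $\{x\}=x-\lfloor x\rfloor$. For a finite set $P\subset[0,1]^d$ with at least two points let \[ h(P)=\sup_{\boldsymbol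 x\in[0,1]^d}\min_{\boldsymbol y\in P}\|\boldsymbol x-\boldsymbol y\|_2,\qquad q(P)=\tfrac12\min_{\boldsymbol x\ne\boldsymbol y\in P}\|\boldsymbol x-\boldsymbol y\|_2,\qquad \rho(P)=\frac{h(P)}{q(P)}. \] Then $N_i$ exists for every $i\ge 2$, and $(P_{N_i,\boldsymbol z^{(i)}})_{i\ge 2}$ is a quasi-uniform family of point sets: $P_{N_i,\boldsymbol z^{(i)}}$ consists of exactly $N_i\ge 2$ points for every $i\ge2$, there is a constant $c>1$ with $N_i<N_{i+1}\le cN_i$ for all $i\ge 2$, and there is a constant $C>0$, independent of $i$, with $\rho(P_{N_i,\boldsymbol z^{(i)}})\le C$ for all $i\ge 2$. -/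

import Mathlib

noncomputable section

namespace QuasiUniform

/-- The closed unit cube `[0,1]^d` in Euclidean space. -/
def unitCube (d : ℕ) : Set (EuclideanSpace ℝ (Fin d)) :=
  {x | ∀ j, x j ∈ Set.Icc (0 : ℝ) 1}

/-- Covering radius (fill distance) of `P` with respect to `[0,1]^d`, Euclidean norm. -/
def coveringRadius {d : ℕ} (P : Set (EuclideanSpace ℝ (Fin d))) : ℝ :=
  sSup ((fun x => Metric.infDist x P) '' unitCube d)

/-- Separation radius of `P`: half of the least Euclidean distance between two distinct points. -/
def separationRadius {d : ℕ} (P : Set (EuclideanSpace ℝ (Fin d))) : ℝ :=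
  (1 / 2) * P.infsep

/-- Mesh ratio `h(P) / q(P)` of `P`. It is only used for finite sets with at least two points,
for which `q(P) > 0`. -/
def meshRatio {d : ℕ} (P : Set (EuclideanSpace ℝ (Fin d))) : ℝ :=
  coveringRadius P / separationRadius P

/-- `(P i)` is a quasi-uniform family of point sets in `[0,1]^d`, where `P i` has exactly `N i`
points. The clause `2 ≤ N i` makes the separation radius meaningful. -/
structure IsQuasiUniformFamily {d : ℕ} (N : ℕ → ℕ)
    (P : ℕ → Set (EuclideanSpace ℝ (Fin d))) : Prop where
  subset_unitCube : ∀ i, P i ⊆ unitCube d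
  finite : ∀ i, (P i).Finite
  ncard_eq : ∀ i, (P i).ncard = N i
  two_le : ∀ i, 2 ≤ N i
  growth : ∃ c : ℝ, 1 < c ∧ ∀ i, N i < N (i + 1) ∧ (N (i + 1) : ℝ) ≤ c * N i
  meshRatio_le : ∃ C : ℝ, 0 < C ∧ ∀ i, meshRatio (P i) ≤ C

/-- The rank-1 lattice point set
`P_{N,z} = {({n z_1 / N}, …, {n z_d / N}) : n = 0, …, N - 1}`. -/
def rankOneLattice {d : ℕ} (N : ℕ) (z : Fin d → ℤ) : Set (EuclideanSpace ℝ (Fin d)) :=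
  (fun n : ℕ => WithLp.toLp 2 (fun j => Int.fract ((n : ℝ) * (z j : ℝ) / (N : ℝ)))) '' Set.Iio N

/-- `⟨x⟩ = max_j min_{k ∈ ℤ} |x_j - k|`, the sup-norm distance to the nearest integer vector. -/
def distInt {d : ℕ} (x : Fin d → ℝ) : ℝ :=
  ⨆ j, ⨅ k : ℤ, |x j - (k : ℝ)|

/-- The integers that qualify in the search step of the algorithm after the value `M`:
all `N > M` with `⟨N α⟩ < ⟨M α⟩`. -/
def improvements {d : ℕ} (α : Fin d → ℝ) (M : ℕ) : Set ℕ :=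
  {N | M < N ∧ distInt (fun j => (N : ℝ) * α j) < distInt (fun j => (M : ℝ) * α j)}

/-- The numbers of points produced by the algorithm, indexed from `0`: `algN α i` is `N_{i+1}`.
So `algN α 0 = N_1 = 1`, and each further value is the smallest improvement of the previous one. -/
def algN {d : ℕ} (α : Fin d → ℝ) : ℕ → ℕ
  | 0 => 1
  | i + 1 => sInf (improvements α (algN α i))

/-- The generating vector that the algorithm outputs with `algN α i`: the coordinatewise nearest
integers to `algN α i * α`. -/
def algZ {d : ℕ} (α : Fin d → ℝ) (i : ℕ) : Fin d → ℤ :=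
  fun j => round ((algN α i : ℝ) * α j)

end QuasiUniform

end

/-! ### Distance to the nearest integer vector; pigeonhole and Dirichlet -/

namespace QuasiUniform

variable {d : ℕ}

/-! Let `ε = ⟨Nα⟩` for an output `N`, and let `L = ℤ^d + ℤ z/N`. Everything rests on `α` being badly
approximable, `N ε^d ≥ c` (`exists_le_mul_distInt_pow`). Pair `(N, z)` with the trace-dual basis of
`1, α`: the resulting field element has size `O(N)` at the given real embedding and `O(ε)` at the
`d` others, while its norm is bounded away from zero.

Dirichlet's theorem gives an improvement of size at most `2^d / ε^d`, so consecutive outputs have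
bounded ratio. Since `N` is a best approximation, `L` is `ε/2`-separated
(`IsBestApprox.half_distInt_le`). As `ε^d` is at least a constant times `1/N`, a pigeonhole argument
bounds the covering radius of `L` by a multiple of `ε` (`exists_norm_sub_lattice_lt`). In the mesh
ratio `ε` cancels. -/

theorem distInt_eq_norm (x : Fin d → ℝ) : distInt x = ‖fun j => x j - (round (x j) : ℝ)‖ := by
  have h : ∀ j, (⨅ k : ℤ, |x j - (k : ℝ)|) = |x j - (round (x j) : ℝ)| := fun j =>
    le_antisymm (ciInf_le ⟨0, by rintro _ ⟨k, rfl⟩; positivity⟩ _)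
      (le_ciInf fun k => round_le _ _)
  unfold distInt
  simp_rw [h]
  refine le_antisymm (Real.iSup_le (fun j => ?_) (norm_nonneg _)) ?_
  · exact norm_le_pi_norm (fun j => x j - (round (x j) : ℝ)) j
  · refine (pi_norm_le_iff_of_nonneg (Real.iSup_nonneg fun j => abs_nonneg _)).2 fun j => ?_
    exact le_ciSup (f := fun j => |x j - (round (x j) : ℝ)|) (Set.finite_range _).bddAbove j

theorem distInt_le_norm (x : Fin d → ℝ) (k : Fin d → ℤ) :
    distInt x ≤ ‖fun j => x j - (k j : ℝ)‖ := by
  rw [distInt_eq_norm]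
  refine (pi_norm_le_iff_of_nonneg (norm_nonneg _)).2 fun j => ?_
  exact (round_le (x j) (k j)).trans (norm_le_pi_norm (fun j => x j - (k j : ℝ)) j)

theorem distInt_nonneg (x : Fin d → ℝ) : 0 ≤ distInt x := by
  rw [distInt_eq_norm]; exact norm_nonneg _

theorem distInt_le_half (x : Fin d → ℝ) : distInt x ≤ 1 / 2 := by
  rw [distInt_eq_norm]
  exact (pi_norm_le_iff_of_nonneg (by norm_num)).2 fun j => abs_sub_round (x j)

theorem distInt_natAbs_le (α : Fin d → ℝ) (a : ℤ) (k : Fin d → ℤ) :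
    distInt (fun j => (a.natAbs : ℝ) * α j) ≤ ‖fun j => (a : ℝ) * α j - (k j : ℝ)‖ := by
  rcases Int.natAbs_eq a with h | h
  · have : (a : ℝ) = (a.natAbs : ℝ) := by conv_lhs => rw [h, Int.cast_natCast]
    rw [this]
    exact distInt_le_norm _ _
  · have : (a : ℝ) = -(a.natAbs : ℝ) := by
      conv_lhs => rw [h, Int.cast_neg, Int.cast_natCast]
    rw [this]
    refine (distInt_le_norm _ (fun j => -k j)).trans_eq ?_
    rw [← norm_neg]
    congr 1
    ext j
    simp only [Pi.neg_apply]
    push_cast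
    ring

/-- Pigeonhole principle for the torus, divided into `m ^ d` cubes of side `1 / m`. -/
theorem exists_norm_sub_lt_inv {ι : Type*} [Fintype ι] (x : ι → Fin d → ℝ) {m : ℕ} (hm : 0 < m)
    (hcard : m ^ d < Fintype.card ι) :
    ∃ i i', i ≠ i' ∧ ∃ k : Fin d → ℤ, ‖fun j => x i j - x i' j - (k j : ℝ)‖ < (m : ℝ)⁻¹ := by
  have hm' : (0 : ℝ) < m := by exact_mod_cast hm
  have hlt : ∀ t : ℝ, ⌊(m : ℝ) * Int.fract t⌋₊ < m := fun t => by
    rw [Nat.floor_lt (by have := Int.fract_nonneg t; positivity)]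
    nlinarith [Int.fract_lt_one t]
  let f : ι → Fin d → Fin m := fun i j => ⟨⌊(m : ℝ) * Int.fract (x i j)⌋₊, hlt _⟩
  obtain ⟨i, i', hne, hf⟩ := Fintype.exists_ne_map_eq_of_card_lt f (by simpa using hcard)
  refine ⟨i, i', hne, fun j => ⌊x i j⌋ - ⌊x i' j⌋, ?_⟩
  refine (pi_norm_lt_iff (by positivity)).2 fun j => ?_
  have hj : ⌊(m : ℝ) * Int.fract (x i j)⌋₊ = ⌊(m : ℝ) * Int.fract (x i' j)⌋₊ :=
    congrArg Fin.val (congrFun hf j)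
  have e : x i j - x i' j - ((⌊x i j⌋ - ⌊x i' j⌋ : ℤ) : ℝ)
      = Int.fract (x i j) - Int.fract (x i' j) := by
    simp only [Int.fract]; push_cast; ring
  rw [e, Real.norm_eq_abs, ← mul_lt_mul_iff_right₀ hm', mul_inv_cancel₀ hm'.ne']
  nth_rewrite 1 [← abs_of_pos hm']
  rw [← abs_mul, mul_sub, abs_lt]
  have n1 : 0 ≤ (m : ℝ) * Int.fract (x i j) := mul_nonneg hm'.le (Int.fract_nonneg _)
  have n2 : 0 ≤ (m : ℝ) * Int.fract (x i' j) := mul_nonneg hm'.le (Int.fract_nonneg _)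
  have a1 := Nat.floor_le n1
  have a2 := Nat.lt_floor_add_one ((m : ℝ) * Int.fract (x i j))
  have a3 := Nat.floor_le n2
  have a4 := Nat.lt_floor_add_one ((m : ℝ) * Int.fract (x i' j))
  rw [hj] at a1 a2
  constructor <;> linarith

/-- Dirichlet's theorem on simultaneous approximation. -/
theorem exists_distInt_lt_inv (α : Fin d → ℝ) {m : ℕ} (hm : 0 < m) :
    ∃ M : ℕ, 1 ≤ M ∧ M ≤ m ^ d ∧ distInt (fun j => (M : ℝ) * α j) < (m : ℝ)⁻¹ := by
  obtain ⟨i, i', hne, k, hk⟩ := exists_norm_sub_lt_inv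
    (fun (n : Fin (m ^ d + 1)) j => ((n : ℕ) : ℝ) * α j) hm (by simp)
  have hne' : (i : ℕ) ≠ i' := fun h => hne (Fin.ext h)
  refine ⟨((i : ℤ) - (i' : ℤ)).natAbs, by omega, by omega, ?_⟩
  refine (distInt_natAbs_le α _ k).trans_lt (lt_of_eq_of_lt ?_ hk)
  congr 1
  ext j
  push_cast
  ring

/-- Rounding `1 / δ` up costs at most a factor 2 because `1 / δ ≥ 1`. -/
theorem exists_nat_inv_le {δ : ℝ} (h0 : 0 < δ) (h1 : δ ≤ 1) :
    ∃ m : ℕ, 0 < m ∧ (m : ℝ)⁻¹ ≤ δ ∧ (m : ℝ) ≤ 2 / δ := by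
  have hinv : 1 ≤ 1 / δ := by rw [le_div_iff₀ h0]; linarith
  refine ⟨⌈1 / δ⌉₊, Nat.ceil_pos.2 (by positivity), ?_, ?_⟩
  · rw [inv_le_comm₀ (by exact_mod_cast Nat.ceil_pos.2 (by positivity)) h0, ← one_div]
    exact Nat.le_ceil _
  · have := Nat.ceil_lt_add_one (a := 1 / δ) (by positivity)
    have e : 2 / δ = 1 / δ + 1 / δ := by ring
    linarith

end QuasiUniform

/-! ### Number fields and bad approximability -/

namespace QuasiUniform

section NumberField

variable {F ι : Type*} [Field F] [Algebra ℚ F] [FiniteDimensional ℚ F] [Fintype ι]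

/-- The conjugates of a basis and of its trace-dual basis form inverse matrices. -/
theorem sum_traceDual_mul_embedding [DecidableEq ι] (b : Module.Basis ι ℚ F) (σ τ : F →ₐ[ℚ] ℂ)
    [Decidable (σ = τ)] :
    ∑ i, σ (b.traceDual i) * τ (b i) = if σ = τ then 1 else 0 := by
  classical
  let A : Matrix ι (F →ₐ[ℚ] ℂ) ℂ := Matrix.of fun i σ => σ (b i)
  let B : Matrix (F →ₐ[ℚ] ℂ) ι ℂ := Matrix.of fun σ i => σ (b.traceDual i)
  have hAB : A * B = 1 := by
    ext i j
    have h := congrArg (algebraMap ℚ ℂ) (b.trace_mul_traceDual i j)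
    rw [trace_eq_sum_embeddings ℂ] at h
    simp only [Matrix.mul_apply, A, B, Matrix.one_apply, Matrix.of_apply]
    simp only [map_mul] at h
    rw [h]
    split_ifs <;> simp
  have hcard : Fintype.card ι = Fintype.card (F →ₐ[ℚ] ℂ) := by
    rw [AlgHom.card, Module.finrank_eq_card_basis b]
  -- Trace duality is `A * B = 1`. There are as many embeddings as basis elements, so the inverse is
  -- two-sided.
  have hBA := (Matrix.mul_eq_one_comm_of_card_eq _ _ _ hcard).1 hAB
  have h := congrFun (congrFun hBA σ) τ
  simp only [Matrix.mul_apply, A, B, Matrix.one_apply, Matrix.of_apply] at h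
  rw [h]
  congr

/-- The norms of the nonzero elements of a finitely generated additive group in a number field are
bounded away from zero. -/
theorem exists_le_prod_norm_embeddings (γ : ι → F) :
    ∃ c : ℝ, 0 < c ∧ ∀ w : ι → ℤ, ∑ i, (w i : ℚ) • γ i ≠ 0 →
      c ≤ ∏ σ : F →ₐ[ℚ] ℂ, ‖σ (∑ i, (w i : ℚ) • γ i)‖ := by
  classical
  -- With a common denominator `D` of the `γ i`, the norm of `D * ξ` is a nonzero integer.
  obtain ⟨D, hD0, hD⟩ := exists_integral_multiples ℤ ℚ (Finset.univ.image γ)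
  refine ⟨((|D| : ℤ) ^ (Module.finrank ℚ F) : ℝ)⁻¹, by positivity, fun w hw => ?_⟩
  set ξ := ∑ i, (w i : ℚ) • γ i with hξ
  have : CharZero F := algebraRat.charZero F
  have hint : IsIntegral ℤ ((D : F) * ξ) := by
    rw [hξ, Finset.mul_sum]
    refine IsIntegral.sum _ fun i _ => ?_
    have : (D : F) * ((w i : ℚ) • γ i) = w i • (D • γ i) := by
      simp only [Algebra.smul_def, eq_intCast, map_intCast]
      ring
    rw [this]
    exact (hD (γ i) (Finset.mem_image_of_mem _ (Finset.mem_univ i))).smul (w i)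
  obtain ⟨n, hn⟩ := IsIntegrallyClosed.isIntegral_iff.1 (Algebra.isIntegral_norm ℚ hint)
  have hn0 : n ≠ 0 := by
    rintro rfl
    rw [map_zero] at hn
    exact mul_ne_zero (Int.cast_ne_zero.2 hD0) hw (Algebra.norm_eq_zero_iff.1 hn.symm)
  have hprod := Algebra.norm_eq_prod_embeddings ℚ ℂ ((D : F) * ξ)
  rw [← hn] at hprod
  have hnorm := congrArg norm hprod
  simp only [map_mul, map_intCast, norm_prod, norm_mul, Finset.prod_mul_distrib,
    Finset.prod_const, Finset.card_univ, AlgHom.card] at hnorm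
  have h1 : (1 : ℝ) ≤ ‖algebraMap ℚ ℂ (algebraMap ℤ ℚ n)‖ := by
    simp only [eq_intCast, map_intCast, Complex.norm_intCast]
    exact_mod_cast Int.one_le_abs hn0
  rw [hnorm] at h1
  rw [inv_le_iff_one_le_mul₀ (by positivity), mul_comm]
  simpa using h1

end NumberField

/-- A vector that together with `1` forms a basis of a real number field is badly approximable. -/
theorem exists_le_mul_distInt_pow {d : ℕ} (α : Fin d → ℝ)
    (K : IntermediateField ℚ ℝ) (hK : Module.finrank ℚ K = d + 1) (hαK : ∀ j, α j ∈ K)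
    (hα : LinearIndependent ℚ (Fin.cons 1 α : Fin (d + 1) → ℝ)) :
    ∃ c : ℝ, 0 < c ∧ ∀ N : ℕ, 1 ≤ N → c ≤ N * distInt (fun j => (N : ℝ) * α j) ^ d := by
  classical
  have : FiniteDimensional ℚ K := FiniteDimensional.of_finrank_pos (by omega)
  let v : Fin (d + 1) → K := Fin.cons 1 fun j => ⟨α j, hαK j⟩
  have hv : ∀ i, ((v i : K) : ℝ) = (Fin.cons 1 α : Fin (d + 1) → ℝ) i := by
    intro i
    refine Fin.cases ?_ (fun j => ?_) i <;> simp [v]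
  have hvli : LinearIndependent ℚ v := by
    refine LinearIndependent.of_comp K.val.toLinearMap ?_
    convert! hα using 1
    exact funext hv
  let b := basisOfLinearIndependentOfCardEqFinrank hvli (by simp [hK])
  have hb : ∀ i, b i = v i := fun i => by simp [b]
  let γ := b.traceDual
  let σ₀ : K →ₐ[ℚ] ℂ := (Complex.ofRealAm.restrictScalars ℚ).comp K.val
  have hσ₀ : ∀ x : K, σ₀ x = ((x : ℝ) : ℂ) := fun x => rfl
  obtain ⟨c, hc, hcw⟩ := exists_le_prod_norm_embeddings (fun i => γ i)
  set C : ℝ := 1 + ∑ σ : K →ₐ[ℚ] ℂ, ∑ i, ‖σ (γ i)‖ with hC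
  have hC1 : 1 ≤ C := le_add_of_nonneg_right (by positivity)
  have hσC : ∀ σ : K →ₐ[ℚ] ℂ, ∑ i, ‖σ (γ i)‖ ≤ C := fun σ => by
    have := Finset.single_le_sum (f := fun σ : K →ₐ[ℚ] ℂ => ∑ i, ‖σ (γ i)‖)
      (fun _ _ => by positivity) (Finset.mem_univ σ)
    linarith
  refine ⟨c / (2 * C ^ (d + 1)), by positivity, fun N hN => ?_⟩
  have hN' : (1 : ℝ) ≤ N := by exact_mod_cast hN
  set ε := distInt (fun j => (N : ℝ) * α j) with hε
  have hε0 : 0 ≤ ε := distInt_nonneg _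
  have hε1 : ε ≤ 1 / 2 := distInt_le_half _
  let w : Fin (d + 1) → ℤ := Fin.cons (N : ℤ) fun j => round ((N : ℝ) * α j)
  have hw : ∀ i, |(w i : ℝ) - N * (b i : ℝ)| ≤ ε := by
    intro i
    rw [hb, hv]
    refine Fin.cases ?_ (fun j => ?_) i
    · simpa [w] using hε0
    · simp only [w, Fin.cons_succ]
      rw [abs_sub_comm, hε, distInt_eq_norm]
      exact norm_le_pi_norm (fun j => (N : ℝ) * α j - (round ((N : ℝ) * α j) : ℝ)) j
  set ξ := ∑ i, (w i : ℚ) • γ i with hξ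
  have hξ0 : ξ ≠ 0 := by
    intro h
    have h0 := Fintype.linearIndependent_iff.1 γ.linearIndependent _ h 0
    simp [w] at h0
    omega
  -- By duality, replacing each `w i` by `N * b i` would turn `σ ξ` into `N` if `σ = σ₀` and into
  -- `0` otherwise; the replacement changes each coefficient by at most `ε`.
  have hconj : ∀ σ : K →ₐ[ℚ] ℂ, ‖σ ξ - N * (if σ = σ₀ then 1 else 0)‖ ≤ C * ε := by
    intro σ
    rw [← sum_traceDual_mul_embedding b σ σ₀, hξ, map_sum, Finset.mul_sum,
      ← Finset.sum_sub_distrib]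
    refine (norm_sum_le _ _).trans ?_
    calc _ ≤ ∑ i, ‖σ (γ i)‖ * ε := Finset.sum_le_sum fun i _ => ?_
      _ ≤ C * ε := by
        rw [← Finset.sum_mul]
        exact mul_le_mul_of_nonneg_right (hσC σ) hε0
    have e : σ ((w i : ℚ) • γ i) - N * (σ (b.traceDual i) * σ₀ (b i))
        = σ (γ i) * (((w i : ℝ) - N * (b i : ℝ) : ℝ) : ℂ) := by
      rw [hσ₀, Algebra.smul_def, map_mul, AlgHom.commutes]
      simp [γ]
      ring
    rw [e, norm_mul, Complex.norm_real]
    exact mul_le_mul_of_nonneg_left (hw i) (norm_nonneg _)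
  have h0 : ‖σ₀ ξ‖ ≤ 2 * C * N := by
    have h := hconj σ₀
    rw [if_pos rfl, mul_one] at h
    have h' := norm_sub_norm_le (σ₀ ξ) (N : ℂ)
    rw [Complex.norm_natCast] at h'
    nlinarith
  have hne : ∀ σ ∈ Finset.univ.erase σ₀, ‖σ ξ‖ ≤ C * ε := fun σ hσ => by
    simpa [Finset.ne_of_mem_erase hσ] using hconj σ
  have hcardE : (Finset.univ.erase σ₀).card = d := by
    rw [Finset.card_erase_of_mem (Finset.mem_univ _), Finset.card_univ, AlgHom.card, hK]
    simp
  have key : c ≤ (2 * C * N) * (C * ε) ^ d := by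
    refine (hcw w hξ0).trans ?_
    rw [← Finset.mul_prod_erase _ _ (Finset.mem_univ σ₀)]
    have hp := Finset.prod_le_prod (fun σ _ => norm_nonneg _) hne
    rw [Finset.prod_const, hcardE] at hp
    exact mul_le_mul h0 hp (by positivity) (by positivity)
  rw [div_le_iff₀ (by positivity)]
  refine key.trans_eq ?_
  rw [mul_pow]
  ring

end QuasiUniform

/-! ### Best approximations; separation and covering for the lattice -/

namespace QuasiUniform

variable {d : ℕ} {α : Fin d → ℝ} {c : ℝ}

theorem distInt_pos_of_le_mul_pow (hd : 1 ≤ d) (hc : 0 < c)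
    (hα : ∀ N : ℕ, 1 ≤ N → c ≤ N * distInt (fun j => (N : ℝ) * α j) ^ d) {N : ℕ} (hN : 1 ≤ N) :
    0 < distInt (fun j => (N : ℝ) * α j) := by
  refine (distInt_nonneg _).lt_of_ne fun h => ?_
  have := hα N hN
  rw [← h, zero_pow (by omega), mul_zero] at this
  linarith

/-- `N` is a best simultaneous approximation denominator of `α`. -/
def IsBestApprox (α : Fin d → ℝ) (N : ℕ) : Prop :=
  1 ≤ N ∧ ∀ M : ℕ, 1 ≤ M → M < N →
    distInt (fun j => (N : ℝ) * α j) < distInt (fun j => (M : ℝ) * α j)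

/-- Dirichlet's theorem at scale `1 / m ≤ ⟨Nα⟩` yields `M ≤ m ^ d`; minimality of `N` rules out `M ≤
N`. -/
theorem IsBestApprox.exists_mem_improvements {N : ℕ} (h : IsBestApprox α N)
    (hpos : 0 < distInt (fun j => (N : ℝ) * α j)) :
    ∃ M ∈ improvements α N, (M : ℝ) * distInt (fun j => (N : ℝ) * α j) ^ d ≤ 2 ^ d := by
  set η := distInt (fun j => (N : ℝ) * α j) with hη
  obtain ⟨m, hm, hm1, hm2⟩ := exists_nat_inv_le hpos ((distInt_le_half _).trans (by norm_num))
  obtain ⟨M, hM1, hM2, hM3⟩ := exists_distInt_lt_inv α hm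
  have hlt := hM3.trans_le hm1
  refine ⟨M, ⟨?_, hlt⟩, ?_⟩
  · by_contra hle
    rcases (not_lt.1 hle).lt_or_eq with h' | h'
    · exact (h.2 M hM1 h').not_gt hlt
    · subst h'
      exact lt_irrefl _ hlt
  · have h1 : (M : ℝ) ≤ (m : ℝ) ^ d := by exact_mod_cast hM2
    calc (M : ℝ) * η ^ d ≤ (2 / η) ^ d * η ^ d := by
          refine mul_le_mul_of_nonneg_right (h1.trans ?_) (by positivity)
          exact pow_le_pow_left₀ (by positivity) hm2 d
      _ = 2 ^ d := by rw [← mul_pow, div_mul_cancel₀ _ hpos.ne']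

/-- An index strictly between `M` and `N` is not an improvement, so it does no better than `M`. -/
theorem IsBestApprox.of_isLeast {M N : ℕ} (h : IsBestApprox α M)
    (hN : IsLeast (improvements α M) N) : IsBestApprox α N := by
  refine ⟨h.1.trans hN.1.1.le, fun n hn hnN => ?_⟩
  refine hN.1.2.trans_le ?_
  rcases lt_trichotomy n M with h' | rfl | h'
  · exact (h.2 n hn h').le
  · exact le_rfl
  · by_contra hlt
    exact (hN.2 ⟨h', not_le.1 hlt⟩).not_gt hnN

theorem isBestApprox_algN
    (hα : ∀ N : ℕ, 1 ≤ N → 0 < distInt (fun j => (N : ℝ) * α j)) (i : ℕ) :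
    IsBestApprox α (algN α i) ∧ IsLeast (improvements α (algN α i)) (algN α (i + 1)) := by
  have aux : ∀ i, IsBestApprox α (algN α i) →
      IsLeast (improvements α (algN α i)) (algN α (i + 1)) := fun i h => by
    -- Nonemptiness is essential: in `ℕ` the infimum of the empty set is `0`.
    obtain ⟨M, hM, -⟩ := h.exists_mem_improvements (hα _ h.1)
    exact ⟨Nat.sInf_mem ⟨M, hM⟩, fun n hn => Nat.sInf_le hn⟩
  have best : ∀ i, IsBestApprox α (algN α i) := fun i => by
    induction i with
    | zero => exact ⟨le_rfl, fun M h1 h2 => by simp only [algN] at h2; omega⟩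
    | succ i ih => exact ih.of_isLeast (aux i ih)
  exact ⟨best i, aux i (best i)⟩

theorem two_le_algN_succ
    (hα : ∀ N : ℕ, 1 ≤ N → 0 < distInt (fun j => (N : ℝ) * α j)) (i : ℕ) :
    2 ≤ algN α (i + 1) := by
  obtain ⟨h1, h2⟩ := isBestApprox_algN hα i
  have := h1.1
  have := h2.1.1
  omega

theorem algN_succ_le (hd : 1 ≤ d) (hc : 0 < c)
    (hα : ∀ N : ℕ, 1 ≤ N → c ≤ N * distInt (fun j => (N : ℝ) * α j) ^ d) (i : ℕ) :
    (algN α (i + 1) : ℝ) ≤ 2 ^ d / c * algN α i := by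
  obtain ⟨h1, h2⟩ := isBestApprox_algN
    (fun N hN => distInt_pos_of_le_mul_pow hd hc hα hN) i
  have hpos := distInt_pos_of_le_mul_pow hd hc hα h1.1
  obtain ⟨M, hM, hM'⟩ := h1.exists_mem_improvements hpos
  have hle : (algN α (i + 1) : ℝ) ≤ M := by exact_mod_cast h2.2 hM
  have hb := hα _ h1.1
  set η := distInt (fun j => (algN α i : ℝ) * α j)
  have hηd : 0 < η ^ d := by positivity
  calc (algN α (i + 1) : ℝ) ≤ 2 ^ d / η ^ d := hle.trans ((le_div_iff₀ hηd).2 hM')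
    _ ≤ 2 ^ d / c * algN α i := by
      rw [div_le_iff₀ hηd, div_mul_eq_mul_div, div_mul_eq_mul_div, le_div_iff₀ hc, mul_assoc]
      exact mul_le_mul_of_nonneg_left hb (by positivity)

/-- Distinct points of the lattice generated by `ℤ^d` and `z / N`, where `z` is the nearest integer
vector to `N α`, are separated by half of `⟨N α⟩`. -/
theorem IsBestApprox.half_distInt_le {N : ℕ} (h : IsBestApprox α N) {a : ℤ}
    (ha : ¬ (N : ℤ) ∣ a) (k : Fin d → ℤ) :
    distInt (fun j => (N : ℝ) * α j) / 2 ≤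
      ‖fun j => (a : ℝ) * (round ((N : ℝ) * α j) : ℝ) / N - (k j : ℝ)‖ := by
  have hN : (0 : ℝ) < N := by exact_mod_cast h.1
  set z : Fin d → ℤ := fun j => round ((N : ℝ) * α j) with hz
  -- Centred residue `|a'| ≤ N / 2`: then `a' α` stays at distance more than `⟨Nα⟩` from `ℤ^d`, and
  -- replacing `a' α` by `a' z / N` costs at most half of that.
  set b := round ((a : ℝ) / N) with hb
  set a' := a - b * N with ha'
  have ha0 : a' ≠ 0 := fun h0 => ha ⟨b, by linarith⟩
  have hhalf : |(a' : ℝ)| ≤ N / 2 := by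
    have := abs_sub_round ((a : ℝ) / N)
    have e : (a' : ℝ) = N * ((a : ℝ) / N - b) := by
      rw [ha']; push_cast; field_simp
    rw [e, abs_mul, abs_of_pos hN]
    nlinarith
  have hnat : (a'.natAbs : ℝ) = |(a' : ℝ)| := by rw [Nat.cast_natAbs, Int.cast_abs]
  have hlt : a'.natAbs < N := by
    have : (a'.natAbs : ℝ) < N := by rw [hnat]; linarith
    exact_mod_cast this
  have h1 := (h.2 _ (Int.natAbs_pos.2 ha0) hlt).trans_le
    (distInt_natAbs_le α a' fun j => k j - b * z j)
  have h2 : (fun j => (a' : ℝ) * α j - ((k j - b * z j : ℤ) : ℝ))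
      = (fun j => (a : ℝ) * (z j : ℝ) / N - (k j : ℝ))
        + ((a' : ℝ) / N) • fun j => (N : ℝ) * α j - (z j : ℝ) := by
    ext j
    simp only [Pi.add_apply, Pi.smul_apply, smul_eq_mul, ha']
    push_cast
    field_simp
    ring
  have h3 : ‖((a' : ℝ) / N) • fun j => (N : ℝ) * α j - (z j : ℝ)‖
      ≤ distInt (fun j => (N : ℝ) * α j) / 2 := by
    rw [norm_smul, hz, ← distInt_eq_norm, Real.norm_eq_abs, abs_div, abs_of_pos hN]
    have : |(a' : ℝ)| / N ≤ 1 / 2 := by rw [div_le_iff₀ hN]; linarith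
    nlinarith [distInt_nonneg (fun j => (N : ℝ) * α j)]
  rw [h2] at h1
  have := norm_add_le (fun j => (a : ℝ) * (z j : ℝ) / N - (k j : ℝ))
    (((a' : ℝ) / N) • fun j => (N : ℝ) * α j - (z j : ℝ))
  linarith

/-- A lattice between `ℤ^d` and `N⁻¹ ℤ^d` that is `δ`-separated with `δ ^ d` comparable to `1 / N`
has covering radius at most a constant multiple of `δ`. -/
theorem exists_norm_sub_lattice_lt {N h : ℕ} (hN : 0 < N) (z : Fin d → ℤ) {δ : ℝ} (hδ : 0 < δ)
    (hδ1 : δ ≤ 1) (hsep : ∀ a : ℤ, ¬ (N : ℤ) ∣ a → ∀ k : Fin d → ℤ,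
      δ ≤ ‖fun j => (a : ℝ) * (z j : ℝ) / N - (k j : ℝ)‖)
    (hh : 2 ^ d < δ ^ d * (N * (h + 1))) (y : Fin d → ℝ) :
    ∃ n < N, ∃ k : Fin d → ℤ,
      ‖fun j => y j - ((n : ℝ) * (z j : ℝ) / N + (k j : ℝ))‖ < (h.factorial : ℝ) * δ := by
  have hN' : (0 : ℝ) < N := by exact_mod_cast hN
  obtain ⟨m, hm, hm1, hm2⟩ := exists_nat_inv_le hδ hδ1
  set H : ℝ := (h.factorial : ℝ) with hH
  have hH0 : 0 < H := Nat.cast_pos.2 h.factorial_pos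
  have hcard : m ^ d < Fintype.card (Fin N × Fin (h + 1)) := by
    rw [Fintype.card_prod, Fintype.card_fin, Fintype.card_fin]
    have : (m : ℝ) ^ d < N * (h + 1) := by
      refine (pow_le_pow_left₀ (by positivity) hm2 d).trans_lt ?_
      rw [div_pow, div_lt_iff₀ (by positivity), mul_comm]
      exact hh
    exact_mod_cast this
  -- Pigeonhole on the points `n z / N + s y / H`: some `(s - s') y / H` is within `δ` of the
  -- lattice, and separation forces `s ≠ s'`.
  obtain ⟨⟨n, s⟩, ⟨n', s'⟩, hne, k, hk⟩ := exists_norm_sub_lt_inv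
    (fun (p : Fin N × Fin (h + 1)) j =>
      ((p.1 : ℕ) : ℝ) * (z j : ℝ) / N + ((p.2 : ℕ) : ℝ) * (y j / H)) hm hcard
  replace hk := hk.trans_le hm1
  have hss : (s : ℤ) - s' ≠ 0 := by
    intro h0
    have hs : s = s' := Fin.ext (by omega)
    subst hs
    have hnn : (n : ℕ) ≠ n' := fun h => hne (by rw [Fin.ext h])
    refine (hsep ((n : ℤ) - n') ?_ k).not_gt (lt_of_eq_of_lt ?_ hk)
    · intro hdvd
      have := Int.eq_zero_of_abs_lt_dvd hdvd (by rw [abs_lt]; omega)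
      omega
    · congr 1
      ext j
      push_cast
      ring
  -- The choice `H = h!` makes every possible `s - s'` a divisor, so multiplying by the integer `t`
  -- recovers `y` with error at most `H * δ`.
  obtain ⟨t, ht⟩ : ((s : ℤ) - s') ∣ (h.factorial : ℤ) := by
    rw [← Int.natAbs_dvd]
    exact Int.natCast_dvd_natCast.2 (Nat.dvd_factorial (Int.natAbs_pos.2 hss) (by omega))
  have htR : H = ((s : ℝ) - s') * t := by
    rw [hH]; exact_mod_cast congrArg (Int.cast : ℤ → ℝ) ht
  have htH : |(t : ℝ)| ≤ H := by
    have h1 : (1 : ℝ) ≤ |(s : ℝ) - s'| := by exact_mod_cast Int.one_le_abs hss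
    have h2 : H = |(s : ℝ) - s'| * |(t : ℝ)| := by
      rw [← abs_mul, ← htR, abs_of_pos hH0]
    nlinarith [abs_nonneg (t : ℝ)]
  have ht0 : 0 < |(t : ℝ)| := by
    refine abs_pos.2 fun h0 => ?_
    rw [h0, mul_zero] at htR
    exact hH0.ne' htR
  set a : ℤ := t * ((n' : ℤ) - n) with ha
  -- Reducing `a` modulo `N` brings the index into `[0, N)`; the quotient contributes an integer
  -- vector.
  have hdm := Int.emod_add_mul_ediv a N
  have hmod0 := Int.emod_nonneg a (b := (N : ℤ)) (by omega)
  have hmodN := Int.emod_lt_of_pos a (b := (N : ℤ)) (by omega)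
  refine ⟨(a % N).toNat, by omega, fun j => a / N * z j + t * k j, ?_⟩
  have hcast : (((a % N).toNat : ℕ) : ℝ) = (t : ℝ) * ((n' : ℝ) - n) - N * ((a / N : ℤ) : ℝ) := by
    have e : (((a % N).toNat : ℕ) : ℤ) = t * ((n' : ℤ) - n) - N * (a / N) := by
      rw [Int.toNat_of_nonneg hmod0, ← ha]; linarith
    exact_mod_cast congrArg (Int.cast : ℤ → ℝ) e
  have hfun : (fun j => y j - ((((a % N).toNat : ℕ) : ℝ) * (z j : ℝ) / N
      + ((a / N * z j + t * k j : ℤ) : ℝ)))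
      = (t : ℝ) • fun j => ((n : ℕ) : ℝ) * (z j : ℝ) / N + ((s : ℕ) : ℝ) * (y j / H)
        - (((n' : ℕ) : ℝ) * (z j : ℝ) / N + ((s' : ℕ) : ℝ) * (y j / H)) - (k j : ℝ) := by
    ext j
    have hy : y j = ((s : ℝ) - s') * t * (y j / H) := by
      rw [← htR]; field_simp
    simp only [Pi.smul_apply, smul_eq_mul]
    rw [hcast]
    conv_lhs => rw [hy]
    push_cast
    field_simp
    ring
  rw [hfun, norm_smul, Real.norm_eq_abs]
  calc _ < |(t : ℝ)| * δ := mul_lt_mul_of_pos_left hk ht0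
    _ ≤ H * δ := mul_le_mul_of_nonneg_right htH hδ.le

end QuasiUniform

/-! ### Point sets in the cube and their mesh ratio -/

namespace QuasiUniform

variable {d : ℕ}

theorem norm_ofLp_le_dist (x y : EuclideanSpace ℝ (Fin d)) :
    ‖fun j => x j - y j‖ ≤ dist x y := by
  refine (pi_norm_le_iff_of_nonneg dist_nonneg).2 fun j => ?_
  rw [dist_eq_norm]
  exact PiLp.norm_apply_le (x - y) j

theorem dist_le_of_forall_abs_sub_le {x y : EuclideanSpace ℝ (Fin d)} {r : ℝ} (hr : 0 ≤ r)
    (h : ∀ j, |x j - y j| ≤ r) : dist x y ≤ √d * r := by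
  rw [EuclideanSpace.dist_eq]
  refine Real.sqrt_le_iff.2 ⟨by positivity, ?_⟩
  rw [mul_pow, Real.sq_sqrt (by positivity)]
  calc _ ≤ ∑ _j : Fin d, r ^ 2 := Finset.sum_le_sum fun j _ => by
        rw [Real.dist_eq]
        exact pow_le_pow_left₀ (abs_nonneg _) (h j) 2
    _ = d * r ^ 2 := by simp

theorem rankOneLattice_subset_unitCube (N : ℕ) (z : Fin d → ℤ) :
    rankOneLattice N z ⊆ unitCube d := by
  rintro _ ⟨n, -, rfl⟩ j
  exact ⟨Int.fract_nonneg _, (Int.fract_lt_one _).le⟩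

theorem finite_rankOneLattice (N : ℕ) (z : Fin d → ℤ) : (rankOneLattice N z).Finite :=
  (Set.finite_Iio N).image _

section Separated

variable {N : ℕ} {z : Fin d → ℤ} {δ : ℝ}

theorem le_dist_of_separated (hsep : ∀ a : ℤ, ¬ (N : ℤ) ∣ a → ∀ k : Fin d → ℤ,
      δ ≤ ‖fun j => (a : ℝ) * (z j : ℝ) / N - (k j : ℝ)‖) {n n' : ℕ} (hn : n < N) (hn' : n' < N)
    (hne : n ≠ n') :
    δ ≤ dist (WithLp.toLp 2 (fun j => Int.fract ((n : ℝ) * (z j : ℝ) / (N : ℝ))) :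
        EuclideanSpace ℝ (Fin d))
      (WithLp.toLp 2 (fun j => Int.fract ((n' : ℝ) * (z j : ℝ) / (N : ℝ)))) := by
  have hdvd : ¬ (N : ℤ) ∣ (n : ℤ) - n' := fun hdvd => by
    have := Int.eq_zero_of_abs_lt_dvd hdvd (by rw [abs_lt]; omega)
    omega
  refine (hsep _ hdvd fun j => ⌊(n : ℝ) * (z j : ℝ) / (N : ℝ)⌋
    - ⌊(n' : ℝ) * (z j : ℝ) / (N : ℝ)⌋).trans (le_of_eq_of_le ?_ (norm_ofLp_le_dist _ _))
  congr 1
  ext j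
  simp only [Int.fract]
  push_cast
  ring

theorem ncard_rankOneLattice (hδ : 0 < δ) (hsep : ∀ a : ℤ, ¬ (N : ℤ) ∣ a → ∀ k : Fin d → ℤ,
      δ ≤ ‖fun j => (a : ℝ) * (z j : ℝ) / N - (k j : ℝ)‖) :
    (rankOneLattice N z).ncard = N := by
  unfold rankOneLattice
  rw [Set.InjOn.ncard_image]
  · simp
  · intro n hn n' hn' heq
    by_contra hne
    have := le_dist_of_separated hsep hn hn' hne
    rw [dist_eq_zero.2 heq] at this
    linarith

theorem half_le_separationRadius (hN : 2 ≤ N) (hδ : 0 < δ)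
    (hsep : ∀ a : ℤ, ¬ (N : ℤ) ∣ a → ∀ k : Fin d → ℤ,
      δ ≤ ‖fun j => (a : ℝ) * (z j : ℝ) / N - (k j : ℝ)‖) :
    δ / 2 ≤ separationRadius (rankOneLattice N z) := by
  have hnt : (rankOneLattice N z).Nontrivial := by
    refine (Set.one_lt_ncard_iff_nontrivial_and_finite.1 ?_).1
    rw [ncard_rankOneLattice hδ hsep]
    omega
  have : δ ≤ (rankOneLattice N z).infsep := by
    refine hnt.le_infsep ?_
    rintro _ ⟨n, hn, rfl⟩ _ ⟨n', hn', rfl⟩ hne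
    exact le_dist_of_separated hsep hn hn' fun h => hne (by rw [h])
  unfold separationRadius
  linarith

/-- If every point of `ℝ^d` is at sup-distance less than `r` from the lattice generated by `ℤ^d` and
`z / N`, then every point of the cube is at sup-distance at most `2 r` from the part of the
lattice in the cube. -/
theorem coveringRadius_rankOneLattice_le {r : ℝ} (hN : 0 < N) (hr : 0 < r)
    (hcov : ∀ y : Fin d → ℝ, ∃ n < N, ∃ k : Fin d → ℤ,
      ‖fun j => y j - ((n : ℝ) * (z j : ℝ) / N + (k j : ℝ))‖ < r) :
    coveringRadius (rankOneLattice N z) ≤ √d * (2 * r) := by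
  refine Real.sSup_le ?_ (by positivity)
  rintro _ ⟨x, hx, rfl⟩
  suffices h : ∃ p ∈ rankOneLattice N z, ∀ j, |x j - p j| ≤ 2 * r by
    obtain ⟨p, hp, hxp⟩ := h
    exact (Metric.infDist_le_dist_of_mem hp).trans
      (dist_le_of_forall_abs_sub_le (by positivity) hxp)
  rcases le_or_gt r (1 / 2) with hr2 | hr2
  -- Clamping `x` to `[r, 1 - r]^d` costs at most `r` and keeps the nearby lattice point inside the
  -- open cube, where it agrees with its fractional part.
  · obtain ⟨n, hn, k, hk⟩ := hcov fun j => max r (min (x j) (1 - r))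
    refine ⟨_, ⟨n, hn, rfl⟩, fun j => ?_⟩
    have hj := (pi_norm_lt_iff hr).1 hk j
    rw [Real.norm_eq_abs, abs_lt] at hj
    obtain ⟨hx0, hx1⟩ := hx j
    set u := max r (min (x j) (1 - r)) with hu
    have hur : r ≤ u := le_max_left _ _
    have hu1 : u ≤ 1 - r := max_le (by linarith) (min_le_right _ _)
    have hux : |x j - u| ≤ r := by
      rw [hu, abs_le]
      rcases le_total (x j) (1 - r) with h1 | h1
      · rw [min_eq_left h1]
        rcases le_total r (x j) with h2 | h2
        · rw [max_eq_right h2]; constructor <;> linarith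
        · rw [max_eq_left h2]; constructor <;> linarith
      · rw [min_eq_right h1, max_eq_right (by linarith)]; constructor <;> linarith
    have hfr : Int.fract ((n : ℝ) * (z j : ℝ) / N) = (n : ℝ) * (z j : ℝ) / N + (k j : ℝ) :=
      Int.fract_eq_iff.2 ⟨by linarith, by linarith, -k j, by push_cast; ring⟩
    change |x j - Int.fract ((n : ℝ) * (z j : ℝ) / N)| ≤ 2 * r
    rw [hfr, abs_le]
    rw [abs_le] at hux
    constructor <;> linarith
  -- Here `2 * r > 1`, so any point of the set will do.
  · have h0 : WithLp.toLp 2 (fun j => Int.fract (((0 : ℕ) : ℝ) * (z j : ℝ) / (N : ℝ))) ∈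
        rankOneLattice N z := ⟨0, hN, rfl⟩
    refine ⟨_, h0, fun j => ?_⟩
    have h1 := hx j
    have h2 := rankOneLattice_subset_unitCube N z h0 j
    rw [abs_le]
    constructor <;> linarith [h1.1, h1.2, h2.1, h2.2]

end Separated

theorem meshRatio_rankOneLattice_le {N h : ℕ} (hN : 2 ≤ N) {z : Fin d → ℤ} {δ : ℝ} (hδ : 0 < δ)
    (hδ1 : δ ≤ 1) (hsep : ∀ a : ℤ, ¬ (N : ℤ) ∣ a → ∀ k : Fin d → ℤ,
      δ ≤ ‖fun j => (a : ℝ) * (z j : ℝ) / N - (k j : ℝ)‖)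
    (hh : 2 ^ d < δ ^ d * (N * (h + 1))) :
    meshRatio (rankOneLattice N z) ≤ 4 * √d * h.factorial := by
  have hq := half_le_separationRadius hN hδ hsep
  have hf : (0 : ℝ) < h.factorial := by exact_mod_cast h.factorial_pos
  have hc := coveringRadius_rankOneLattice_le (by omega) (mul_pos hf hδ)
    (exists_norm_sub_lattice_lt (by omega) z hδ hδ1 hsep hh)
  unfold meshRatio
  rw [div_le_iff₀ (by linarith)]
  calc _ ≤ √d * (2 * (h.factorial * δ)) := hc
    _ = 4 * √d * h.factorial * (δ / 2) := by ring
    _ ≤ _ := mul_le_mul_of_nonneg_left hq (by positivity)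

end QuasiUniform

/-- The first conjunct says that every search step of the algorithm succeeds, so that the sequence
is well defined; the second one is about the outputs with index `i > 1`, hence the shift. -/
theorem theorem3p1 (d : ℕ) (hd : 1 ≤ d) (α : Fin d → ℝ)
    (K : IntermediateField ℚ ℝ) (hK : Module.finrank ℚ K = d + 1)
    (hαK : ∀ j, α j ∈ K)
    (hα : LinearIndependent ℚ (Fin.cons 1 α : Fin (d + 1) → ℝ)) :
    (∀ i, IsLeast (QuasiUniform.improvements α (QuasiUniform.algN α i))
      (QuasiUniform.algN α (i + 1))) ∧
    QuasiUniform.IsQuasiUniformFamily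
      (fun i => QuasiUniform.algN α (i + 1))
      (fun i => QuasiUniform.rankOneLattice (QuasiUniform.algN α (i + 1))
        (QuasiUniform.algZ α (i + 1))) := by
  obtain ⟨c, hc, hbad⟩ := QuasiUniform.exists_le_mul_distInt_pow α K hK hαK hα
  have hpos : ∀ N : ℕ, 1 ≤ N → 0 < QuasiUniform.distInt (fun j => (N : ℝ) * α j) :=
    fun N hN => QuasiUniform.distInt_pos_of_le_mul_pow hd hc hbad hN
  have hbest := fun i => (QuasiUniform.isBestApprox_algN hpos i).1
  have hleast := fun i => (QuasiUniform.isBestApprox_algN hpos i).2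
  have htwo := QuasiUniform.two_le_algN_succ hpos
  have hδ := fun i => half_pos (hpos _ (hbest (i + 1)).1)
  have hsep := fun i (a : ℤ) ha k => (hbest (i + 1)).half_distInt_le (a := a) ha k
  refine ⟨hleast, fun i => QuasiUniform.rankOneLattice_subset_unitCube _ _,
    fun i => QuasiUniform.finite_rankOneLattice _ _,
    fun i => QuasiUniform.ncard_rankOneLattice (hδ i) (hsep i), htwo,
    ⟨2 ^ d / c + 1, by linarith [show 0 < 2 ^ d / c by positivity], fun i =>
      ⟨(hleast (i + 1)).1.1, ?_⟩⟩, ?_⟩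
  · refine (QuasiUniform.algN_succ_le hd hc hbad (i + 1)).trans ?_
    exact mul_le_mul_of_nonneg_right (by linarith) (Nat.cast_nonneg _)
  -- With `δ = η / 2`, the pigeonhole condition reads `4 ^ d < N * η ^ d * (h + 1)`, and `N * η ^ d
  -- ≥ c` uniformly in `i`.
  · obtain ⟨h, hh⟩ := exists_nat_gt (4 ^ d / c)
    have hd' : (0 : ℝ) < d := by exact_mod_cast hd
    refine ⟨4 * √d * h.factorial, by positivity, fun i => ?_⟩
    refine QuasiUniform.meshRatio_rankOneLattice_le (htwo i) (hδ i) ?_ (hsep i) ?_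
    · linarith [QuasiUniform.distInt_le_half
        (fun j => (QuasiUniform.algN α (i + 1) : ℝ) * α j)]
    · have hb := hbad _ (hbest (i + 1)).1
      set η := QuasiUniform.distInt (fun j => (QuasiUniform.algN α (i + 1) : ℝ) * α j)
      set N : ℝ := (QuasiUniform.algN α (i + 1) : ℝ)
      rw [div_lt_iff₀ hc] at hh
      have h4 : (4 : ℝ) ^ d < N * η ^ d * (h + 1) := by
        have : (h : ℝ) * c ≤ h * (N * η ^ d) := mul_le_mul_of_nonneg_left hb (Nat.cast_nonneg _)
        linarith
      have h22 : (4 : ℝ) ^ d = 2 ^ d * 2 ^ d := by rw [← mul_pow]; norm_num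
      rw [div_pow, div_mul_eq_mul_div, lt_div_iff₀ (by positivity), ← h22]
      linarith
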